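/- Let $\mathcal H$ be a Krein space, i.e. a complex Hilbertizable Banach space with a continuous hermitian form $\langle\cdot,\cdot\rangle$ (antilinear in the first variable) such that every continuous linear form on $\mathcal H$ is $\langle u,\cdot\rangle$ for a unique $u\in\mathcal H$. Let $H$ be a definitizable operator on $\mathcal H$: $H$ is densely defined and selfadjoint with respect to $\langle\cdot,\cdot\rangle$, $\rho(H)\neq\emptyset$, and there is a definitizing polynomial for $H$, i.e. a nonzero real polynomial $p$, of degree $n$ say, with $\langle u,p(H)u\rangle\ge 0$ for all $u\in\mathrm{Dom}\,H^n$. For a definitizing polynomial $p$ let $\beta_p(\xi)$, $\xi\in\mathbb C$, be the multiplicity of $\xi$ as a zero of $p$, and let $\beta_p(\infty)$ be $0$ if $\deg p$ is even and $1$ if $\deg p$ is odd. Let $\alpha_H:\mathbb C\cup\{\infty\}\to\mathbb N$ be the pointwise infimum of the functions $\beta_p$ over all definitizing polynomials $p$ for $H$. Put $\sigma_{\mathbb C}(H)=\sigma(H)\setminus\mathbb R$ and let $c(H)=\{\xi\in\mathbb R:\alpha_H(\xi)\neq0\}$ be the set of finite critical points of $H$. Then $\sigma_{\mathbb C}(H)$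 and $c(H)$ are finite, $\alpha_H(\infty)\in\{0,1\}$, and there exists $c>0$ such that every $z\in\mathbb C\setminus(\sigma_{\mathbb C}(H)\cup\mathbb R)$ belongs to $\rho(H)$ and satisfies $$c\,\|(H-z)^{-1}\|\le\sum_{\xi\in\sigma_{\mathbb C}(H)}|z-\xi|^{-\alpha_H(\xi)}+|\mathrm{Im}\,z|^{-1}\Big(1+\sum_{\xi\in c(H)}|z-\xi|^{-\alpha_H(\xi)}+|z|^{\alpha_H(\infty)}\Big).$$ -/

import Mathlib

open scoped ComplexConjugate OnePoint Polynomial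

noncomputable section

namespace KreinResolvent

variable {E : Type*} [NormedAddCommGroup E] [NormedSpace ℂ E]

/-- The topology of `E` is given by the norm of some scalar product: there is a scalar product
(antilinear in the first variable) whose norm is equivalent to the given norm. -/
def Hilbertizable (E : Type*) [NormedAddCommGroup E] [NormedSpace ℂ E] : Prop :=
  ∃ (s : InnerProductSpace.Core ℂ E) (a b : ℝ), 0 < a ∧ 0 < b ∧
    ∀ x : E, a * ‖x‖ ^ 2 ≤ (s.inner x x).re ∧ (s.inner x x).re ≤ b * ‖x‖ ^ 2

/-- A Krein structure on `E`: a continuous hermitian form, antilinear in the first variable and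
linear in the second one, such that every continuous linear form is `form u` for a unique `u`;
the space is required to be Hilbertizable. Together with completeness of `E` this makes `E` a
Krein space. -/
structure KreinStructure (E : Type*) [NormedAddCommGroup E] [NormedSpace ℂ E] where
  form : E →L⋆[ℂ] E →L[ℂ] ℂ
  hermitian : ∀ u v : E, form u v = conj (form v u)
  represents : ∀ φ : E →L[ℂ] ℂ, ∃! u : E, form u = φ
  hilbertizable : Hilbertizable E

/-! ### Unbounded operators: resolvent, powers, polynomials -/

/-- `R` is a bounded (everywhere defined) two-sided inverse of `T - z`. -/
def IsResolventAt (T : E →ₗ.[ℂ] E) (z : ℂ) (R : E →L[ℂ] E) : Prop :=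
  (∀ x : E, ∃ h : R x ∈ T.domain, T ⟨R x, h⟩ - z • R x = x) ∧
    ∀ x : T.domain, R (T x - z • (x : E)) = x

/-- The resolvent set `ρ(T)`. -/
def resolventSet (T : E →ₗ.[ℂ] E) : Set ℂ := {z | ∃ R : E →L[ℂ] E, IsResolventAt T z R}

/-- The nonreal spectrum `σ(T) \ ℝ`. -/
def nonrealSpectrum (T : E →ₗ.[ℂ] E) : Set ℂ := {z | z ∉ resolventSet T ∧ z.im ≠ 0}

open Classical in
/-- The resolvent `(T - z)⁻¹` for `z ∈ ρ(T)` (and `0` for other `z`). -/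
def resolvent (T : E →ₗ.[ℂ] E) (z : ℂ) : E →L[ℂ] E :=
  if h : z ∈ resolventSet T then Classical.choose h else 0

theorem IsResolventAt.unique {T : E →ₗ.[ℂ] E} {z : ℂ} {R R' : E →L[ℂ] E}
    (h : IsResolventAt T z R) (h' : IsResolventAt T z R') : R = R' := by
  ext x
  obtain ⟨hx, hRx⟩ := h.1 x
  have h2 := h'.2 ⟨R x, hx⟩
  simp only [hRx] at h2
  exact h2.symm

theorem isResolventAt_resolvent {T : E →ₗ.[ℂ] E} {z : ℂ} (h : z ∈ resolventSet T) :
    IsResolventAt T z (resolvent T z) := by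
  rw [resolvent, dif_pos h]
  exact Classical.choose_spec h

theorem IsResolventAt.resolvent_eq {T : E →ₗ.[ℂ] E} {z : ℂ} {R : E →L[ℂ] E}
    (h : IsResolventAt T z R) : resolvent T z = R :=
  (isResolventAt_resolvent ⟨R, h⟩).unique h

/-- The composition `S ∘ T` on its natural domain `{u ∈ Dom T | T u ∈ Dom S}`. -/
def opComp (S T : E →ₗ.[ℂ] E) : E →ₗ.[ℂ] E where
  domain := (S.domain.comap T.toFun).map T.domain.subtype
  toFun :=
    { toFun := fun u => S ⟨T ⟨u, by
          obtain ⟨v, -, hv⟩ := u.2; rw [← hv]; exact v.2⟩, by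
          obtain ⟨u, v, hv, rfl⟩ := u; exact hv⟩
      map_add' := fun u v => by
        rw [← S.map_add]
        congr 1
        ext
        exact T.map_add ⟨(u : E), _⟩ ⟨(v : E), _⟩
      map_smul' := fun c u => by
        rw [RingHom.id_apply, ← S.map_smul]
        congr 1
        ext
        exact T.map_smul c ⟨(u : E), _⟩ }

theorem mem_opComp_domain {S T : E →ₗ.[ℂ] E} {u : E} :
    u ∈ (opComp S T).domain ↔ ∃ h : u ∈ T.domain, T ⟨u, h⟩ ∈ S.domain := by
  constructor
  · rintro ⟨v, hv, rfl⟩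
    exact ⟨v.2, hv⟩
  · rintro ⟨h, hS⟩
    exact ⟨⟨u, h⟩, hS, rfl⟩

/-- The powers `T ^ n` on their natural domains `Dom T ^ n`. -/
def opPow (T : E →ₗ.[ℂ] E) : ℕ → (E →ₗ.[ℂ] E)
  | 0 => (LinearMap.id : E →ₗ[ℂ] E).toPMap ⊤
  | n + 1 => opComp T (opPow T n)

theorem opPow_domain_antitone (T : E →ₗ.[ℂ] E) : Antitone fun n => (opPow T n).domain :=
  antitone_nat_of_succ_le fun _ _ hu => (mem_opComp_domain.1 hu).1

/-- `p(T) = ∑ k, aₖ T ^ k` with domain `Dom T ^ n`, where `p` is a real polynomial of degree `n`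
with coefficients `aₖ`. -/
def opPoly (T : E →ₗ.[ℂ] E) (p : ℝ[X]) : E →ₗ.[ℂ] E where
  domain := (opPow T p.natDegree).domain
  toFun :=
    { toFun := fun u => ∑ k : Fin (p.natDegree + 1), ((p.coeff k : ℝ) : ℂ) •
        opPow T k ⟨u, opPow_domain_antitone T (Nat.lt_succ_iff.1 k.2) u.2⟩
      map_add' := fun u v => by
        rw [← Finset.sum_add_distrib]
        refine Finset.sum_congr rfl fun k _ => ?_
        rw [← smul_add, ← LinearPMap.map_add]
        rfl
      map_smul' := fun c u => by
        rw [RingHom.id_apply, Finset.smul_sum]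
        refine Finset.sum_congr rfl fun k _ => ?_
        rw [smul_comm c]
        exact congrArg _ ((opPow T k).map_smul c ⟨(u : E), _⟩) }

theorem opPoly_apply (T : E →ₗ.[ℂ] E) (p : ℝ[X]) (u : (opPoly T p).domain) :
    opPoly T p u = ∑ k : Fin (p.natDegree + 1), ((p.coeff k : ℝ) : ℂ) •
      opPow T k ⟨u, opPow_domain_antitone T (Nat.lt_succ_iff.1 k.2) u.2⟩ := rfl

/-! ### Definitizable operators -/

/-- `T` is selfadjoint for the Krein structure: it is densely defined and equal to its adjoint,
the graph of the adjoint being `{(u, w) | ∀ v ∈ Dom T, ⟨w, v⟩ = ⟨u, T v⟩}`. -/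
def IsSelfAdjointOp (K : KreinStructure E) (T : E →ₗ.[ℂ] E) : Prop :=
  Dense (T.domain : Set E) ∧
    ∀ u w : E, (u, w) ∈ T.graph ↔ ∀ v : T.domain, K.form w v = K.form u (T v)

/-- `S ≥ 0`: the number `⟨u, S u⟩` is real and nonnegative for every `u ∈ Dom S`. -/
def IsPositiveOp (K : KreinStructure E) (S : E →ₗ.[ℂ] E) : Prop :=
  ∀ u : S.domain, (K.form u (S u)).im = 0 ∧ 0 ≤ (K.form u (S u)).re

/-- `p` is a definitizing polynomial for `T`. -/
def IsDefinitizing (K : KreinStructure E) (T : E →ₗ.[ℂ] E) (p : ℝ[X]) : Prop :=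
  p ≠ 0 ∧ IsPositiveOp K (opPoly T p)

/-- `T` is a definitizable selfadjoint operator. -/
structure IsDefinitizable (K : KreinStructure E) (T : E →ₗ.[ℂ] E) : Prop where
  selfAdjoint : IsSelfAdjointOp K T
  resolventSet_nonempty : (resolventSet T).Nonempty
  exists_definitizing : ∃ p : ℝ[X], IsDefinitizing K T p

/-- The order of a real polynomial `p` at a point of `ℂ ∪ {∞}`: the multiplicity of `ξ` as a zero
of `p` at `ξ ∈ ℂ`, and at `∞` the parity (`0` or `1`) of the degree of `p`. -/
def polyOrder (p : ℝ[X]) (ω : OnePoint ℂ) : ℕ :=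
  ω.elim (if Even p.natDegree then 0 else 1)
    fun ξ => (p.map (algebraMap ℝ ℂ)).rootMultiplicity ξ

/-- The order function `α_T`: the pointwise infimum of the orders of the definitizing polynomials
of `T`. -/
def orderFun (K : KreinStructure E) (T : E →ₗ.[ℂ] E) (ω : OnePoint ℂ) : ℕ :=
  sInf {k | ∃ p : ℝ[X], IsDefinitizing K T p ∧ polyOrder p ω = k}

/-- The finite critical points of `T`: the real numbers at which the order function of `T` does
not vanish. -/
def realCriticalPoints (K : KreinStructure E) (T : E →ₗ.[ℂ] E) : Set ℝ :=
  {ξ | orderFun K T ((ξ : ℂ) : OnePoint ℂ) ≠ 0}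

end KreinResolvent

end

/-! Fix a nonreal `w` in the resolvent set, a definitizing polynomial `p` of degree `n`, and `m`
with `n ≤ 2 m`. The bounded operator `A = p(H) (H - w)⁻ᵐ (H - conj w)⁻ᵐ` is positive for the Krein
form, because the two resolvents are adjoint to each other, and `H` is symmetric for the
semidefinite form `⟨·, A ·⟩`. The Hilbert space argument with Cauchy–Schwarz then gives `A (H - z)⁻¹
= O(|Im z|⁻¹)` (`IsPositiveBounded.exists_im_mul_norm_le`).

With `q(z) = p(z) / ((z - w) (z - conj w)) ^ m`, the operator `A` is `q(H)`, a polynomial in the two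
resolvents. Hence `A - q(z)` is divisible by `H - z`, and `(A - q(z)) (H - z)⁻¹ = O(|Im z|⁻¹)` away
from `w` and `conj w` (`approxSubalgebra`). Subtracting, `|q(z)| ‖(H - z)⁻¹‖ = O(|Im z|⁻¹)`: this is
`IsSelfAdjointOp.exists_definitizing_bound`. It also shows that the nonreal spectrum consists of
zeros of `p`, since bounds at `z` and `conj z` together make `H - z` invertible.

The estimate is local on the Riemann sphere, so at each point `p` may be chosen with the least order
there: `|p(z)|` is then at least of order `|z - ω| ^ α(ω)`, and at infinity the least `m` gives
`|q(z)|` of order `|z| ^ (-α(∞))`. Compactness glues the local estimates together. -/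

namespace KreinResolvent

/-! ### Selfadjoint operators in a Krein space: inverse bounds and the resolvent set. -/

section Basic

variable {E : Type*} [NormedAddCommGroup E] [NormedSpace ℂ E]

/-- A closed proper subspace of a normed space is annihilated by a nonzero continuous linear
form. -/
theorem exists_ne_zero_forall_mem_eq_zero (V : Submodule ℂ E) (hV : IsClosed (V : Set E))
    (hne : V ≠ ⊤) : ∃ φ : E →L[ℂ] ℂ, φ ≠ 0 ∧ ∀ x ∈ V, φ x = 0 := by
  obtain ⟨x, -, hx⟩ := SetLike.exists_of_lt (lt_top_iff_ne_top.2 hne)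
  have : IsClosed (V : Set E) := hV
  have hx0 : ‖(Submodule.Quotient.mk x : E ⧸ V)‖ ≠ 0 := by
    rw [norm_ne_zero_iff]
    exact fun h => hx ((Submodule.Quotient.mk_eq_zero V).1 h)
  obtain ⟨g, -, hg⟩ := exists_dual_vector ℂ (Submodule.Quotient.mk x : E ⧸ V) hx0
  refine ⟨g.comp V.mkQL, fun h => hx0 ?_, fun y hy => ?_⟩
  · have h1 := DFunLike.congr_fun h x
    have h2 : g (Submodule.Quotient.mk x) = 0 := h1
    rw [hg] at h2
    exact RCLike.ofReal_eq_zero.1 h2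
  · have h2 : (Submodule.Quotient.mk y : E ⧸ V) = 0 := (Submodule.Quotient.mk_eq_zero V).2 hy
    change g (Submodule.Quotient.mk y) = 0
    rw [h2, map_zero]

variable (K : KreinStructure E)

theorem KreinStructure.form_injective : Function.Injective K.form := fun _ v huv =>
  (K.represents (K.form v)).unique huv rfl

/-- Open mapping theorem for `u ↦ ⟨u, ·⟩`. It turns bounds tested against the form into norm bounds.
-/
theorem KreinStructure.exists_norm_le [CompleteSpace E] :
    ∃ C : ℝ, 0 < C ∧ ∀ u : E, ‖u‖ ≤ C * ‖K.form u‖ := by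
  obtain ⟨C, hC, h⟩ := ContinuousLinearMap.exists_preimage_norm_le K.form
    fun φ => (K.represents φ).exists
  refine ⟨C, hC, fun u => ?_⟩
  obtain ⟨v, hv, hvu⟩ := h (K.form u)
  rwa [K.form_injective hv] at hvu

variable {K} {T : E →ₗ.[ℂ] E}

theorem IsSelfAdjointOp.form_apply (hT : IsSelfAdjointOp K T) (u v : T.domain) :
    K.form (T u) v = K.form u (T v) :=
  (hT.2 u (T u)).1 (T.mem_graph u) v

theorem IsSelfAdjointOp.isClosed_graph (hT : IsSelfAdjointOp K T) :
    IsClosed (T.graph : Set (E × E)) := by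
  have h : (T.graph : Set (E × E)) =
      ⋂ v : T.domain, {x | K.form x.2 v = K.form x.1 (T v)} := by
    ext ⟨u, w⟩
    simp only [SetLike.mem_coe, hT.2 u w, Set.mem_iInter, Set.mem_ofPred_eq]
  rw [h]
  refine isClosed_iInter fun v => isClosed_eq ?_ ?_
  · exact (K.form.continuous.comp continuous_snd).clm_apply continuous_const
  · exact (K.form.continuous.comp continuous_fst).clm_apply continuous_const

/-- `C` bounds the inverse of the injective map `T - z`. -/
def InverseBound (T : E →ₗ.[ℂ] E) (z : ℂ) (C : ℝ) : Prop :=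
  ∀ u : T.domain, ‖(u : E)‖ ≤ C * ‖T u - z • (u : E)‖

theorem IsResolventAt.inverseBound {z : ℂ} {R : E →L[ℂ] E} (hR : IsResolventAt T z R) :
    InverseBound T z ‖R‖ := fun u => by
  conv_lhs => rw [← hR.2 u]
  exact R.le_opNorm _

theorem InverseBound.norm_resolvent_le {z : ℂ} {C : ℝ} (h : InverseBound T z C) (hC : 0 ≤ C)
    (hz : z ∈ resolventSet T) : ‖resolvent T z‖ ≤ C := by
  refine ContinuousLinearMap.opNorm_le_bound _ hC fun x => ?_
  obtain ⟨hx, hRx⟩ := (isResolventAt_resolvent hz).1 x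
  simpa [hRx] using h ⟨_, hx⟩

theorem InverseBound.perturb {z z' : ℂ} {C : ℝ} (h : InverseBound T z C) (hC : 0 ≤ C)
    (hz : C * ‖z' - z‖ ≤ 1 / 2) : InverseBound T z' (2 * C) := fun u => by
  have h1 : T u - z • (u : E) = (T u - z' • (u : E)) + (z' - z) • (u : E) := by
    rw [sub_smul]; abel
  have h2 := h u
  rw [h1] at h2
  have h3 := norm_add_le (T u - z' • (u : E)) ((z' - z) • (u : E))
  rw [norm_smul] at h3
  have h4 := mul_le_mul_of_nonneg_left h3 hC
  have h5 := mul_le_mul_of_nonneg_right hz (norm_nonneg (u : E))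
  nlinarith

theorem IsSelfAdjointOp.form_resolvent (hT : IsSelfAdjointOp K T) {z : ℂ} {S S' : E →L[ℂ] E}
    (hS : IsResolventAt T z S) (hS' : IsResolventAt T (conj z) S') (u v : E) :
    K.form (S' u) v = K.form u (S v) := by
  obtain ⟨hv, hSv⟩ := hS.1 v
  obtain ⟨hu, hSu⟩ := hS'.1 u
  conv_lhs => rw [← hSv]
  conv_rhs => rw [← hSu]
  rw [map_sub, map_smul, ← hT.form_apply ⟨S' u, hu⟩ ⟨S v, hv⟩]
  simp

/-- Near every point of the resolvent set there are uniform bounds for the inverse of `T - z`. -/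
theorem eventually_inverseBound {z : ℂ} (hz : z ∈ resolventSet T) :
    ∃ C : ℝ, 0 ≤ C ∧ ∀ᶠ z' in nhds z, InverseBound T z' C := by
  have h := (isResolventAt_resolvent hz).inverseBound
  refine ⟨2 * ‖resolvent T z‖, by positivity, ?_⟩
  have hc : Filter.Tendsto (fun z' => ‖resolvent T z‖ * ‖z' - z‖) (nhds z) (nhds 0) := by
    have : Continuous fun z' => ‖resolvent T z‖ * ‖z' - z‖ := by fun_prop
    simpa using this.tendsto z
  filter_upwards [hc.eventually (ge_mem_nhds (by norm_num : (0 : ℝ) < 1 / 2))] with z' hz'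
  exact h.perturb (norm_nonneg _) hz'

variable [CompleteSpace E]

/-- On the graph, which is complete, `T - z` becomes a bounded operator that is bounded below, so
its range is closed. A functional annihilating the range is `⟨w, ·⟩` with `w` in the kernel of `T -
conj z`, and the second bound makes this kernel trivial. -/
theorem IsSelfAdjointOp.mem_resolventSet (hT : IsSelfAdjointOp K T) {z : ℂ} {C C' : ℝ}
    (h : InverseBound T z C) (h' : InverseBound T (conj z) C') : z ∈ resolventSet T := by
  have hG := hT.isClosed_graph
  have : CompleteSpace T.graph := hG.completeSpace_coe
  set g : T.graph →L[ℂ] E :=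
    (ContinuousLinearMap.snd ℂ E E - z • ContinuousLinearMap.fst ℂ E E).comp T.graph.subtypeL
    with hg
  have hgx : ∀ x : T.graph, g x = x.1.2 - z • x.1.1 := fun x => rfl
  have hgT : ∀ u : T.domain, g ⟨_, T.mem_graph u⟩ = T u - z • (u : E) := fun u => rfl
  have hgr : ∀ x : T.graph, ∃ u : T.domain, x = ⟨_, T.mem_graph u⟩ := fun x => by
    obtain ⟨u, h1, h2⟩ := (T.mem_graph_iff).1 x.2
    exact ⟨u, Subtype.ext (Prod.ext h1.symm h2.symm)⟩
  have hbound : ∀ x : T.graph, ‖x‖ ≤ (1 + (1 + ‖z‖) * |C|) * ‖g x‖ := fun x => by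
    obtain ⟨u, rfl⟩ := hgr x
    rw [hgT]
    have h1 : ‖(u : E)‖ ≤ |C| * ‖T u - z • (u : E)‖ :=
      (h u).trans (mul_le_mul_of_nonneg_right (le_abs_self C) (norm_nonneg _))
    have h2 : ‖T u‖ ≤ ‖T u - z • (u : E)‖ + ‖z‖ * ‖(u : E)‖ := by
      rw [← norm_smul]
      simpa using norm_add_le (T u - z • (u : E)) (z • (u : E))
    have h3 := mul_le_mul_of_nonneg_left h1 (norm_nonneg z)
    have h4 : 0 ≤ |C| * ‖T u - z • (u : E)‖ := by positivity
    have h5 : 0 ≤ ‖z‖ * (|C| * ‖T u - z • (u : E)‖) := by positivity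
    refine max_le ?_ ?_
    · change ‖(u : E)‖ ≤ _
      nlinarith [norm_nonneg (T u - z • (u : E))]
    · change ‖T u‖ ≤ _
      nlinarith [norm_nonneg (T u - z • (u : E))]
  have hanti : AntilipschitzWith (Real.toNNReal (1 + (1 + ‖z‖) * |C|)) g :=
    ContinuousLinearMap.antilipschitz_of_bound g fun x => by
      rw [Real.coe_toNNReal _ (by positivity)]
      exact hbound x
  have hker : g.ker = ⊥ := LinearMap.ker_eq_bot.2 hanti.injective
  have hran : g.range = ⊤ := by
    by_contra hne
    obtain ⟨φ, hφ0, hφ⟩ := exists_ne_zero_forall_mem_eq_zero g.range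
      (hanti.isClosed_range g.uniformContinuous) hne
    obtain ⟨w, rfl⟩ := (K.represents φ).exists
    refine hφ0 ?_
    have hw : (w, conj z • w) ∈ T.graph := by
      refine (hT.2 _ _).2 fun v => ?_
      have h1 : K.form w (T v - z • (v : E)) = 0 := hφ _ ⟨⟨_, T.mem_graph v⟩, rfl⟩
      rw [map_sub, map_smul, sub_eq_zero] at h1
      rw [h1, map_smulₛₗ]
      simp
    obtain ⟨u, h1, h2⟩ := (T.mem_graph_iff).1 hw
    have h3 := h' u
    simp only at h1 h2
    rw [h2, h1, sub_self, norm_zero, mul_zero, norm_le_zero_iff] at h3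
    rw [h3, map_zero]
  let e := ContinuousLinearEquiv.ofBijective g hker hran
  have he : ∀ x, e x = g x := fun x => rfl
  refine ⟨((ContinuousLinearMap.fst ℂ E E).comp T.graph.subtypeL).comp
    (e.symm : E →L[ℂ] T.graph), fun x => ?_, fun u => ?_⟩
  · obtain ⟨u, hu⟩ := hgr (e.symm x)
    have h1 : (((ContinuousLinearMap.fst ℂ E E).comp T.graph.subtypeL).comp
        (e.symm : E →L[ℂ] T.graph)) x = u := congrArg (fun y : T.graph => y.1.1) hu
    have h2 : T u - z • (u : E) = x := by
      rw [← hgT, ← hu, ← he, e.apply_symm_apply]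
    refine ⟨h1 ▸ u.2, ?_⟩
    have h3 : (⟨_, h1 ▸ u.2⟩ : T.domain) = u := Subtype.ext h1
    rw [h3, h1, h2]
  · have h1 : e.symm (T u - z • (u : E)) = ⟨_, T.mem_graph u⟩ := by
      rw [← hgT, ← he, e.symm_apply_apply]
    change ((e.symm (T u - z • (u : E))).1.1) = (u : E)
    rw [h1]

/-- Duality: `⟨u, v⟩ = ⟨(T - conj z) u, (T - z)⁻¹ v⟩`. -/
theorem IsSelfAdjointOp.exists_inverseBound_conj (hT : IsSelfAdjointOp K T) {z : ℂ}
    (hz : z ∈ resolventSet T) : ∃ C : ℝ, InverseBound T (conj z) C := by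
  obtain ⟨S, hS⟩ := hz
  obtain ⟨C, hC, hK⟩ := K.exists_norm_le
  refine ⟨C * (‖K.form‖ * ‖S‖), fun u => (hK u).trans ?_⟩
  rw [mul_assoc]
  refine mul_le_mul_of_nonneg_left ?_ hC.le
  refine ContinuousLinearMap.opNorm_le_bound _ (by positivity) fun v => ?_
  obtain ⟨hv, hSv⟩ := hS.1 v
  have h1 : K.form u v = K.form (T u - conj z • (u : E)) (S v) := by
    conv_lhs => rw [← hSv]
    rw [map_sub, map_smul, ← hT.form_apply u ⟨S v, hv⟩]
    simp
  rw [h1]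
  calc _ ≤ ‖K.form‖ * ‖T u - conj z • (u : E)‖ * ‖S v‖ := K.form.le_opNorm₂ _ _
    _ ≤ ‖K.form‖ * ‖T u - conj z • (u : E)‖ * (‖S‖ * ‖v‖) := by
      gcongr
      exact S.le_opNorm v
    _ = _ := by ring

theorem IsSelfAdjointOp.conj_mem_resolventSet (hT : IsSelfAdjointOp K T) {z : ℂ}
    (hz : z ∈ resolventSet T) : conj z ∈ resolventSet T := by
  obtain ⟨C, hC⟩ := hT.exists_inverseBound_conj hz
  refine hT.mem_resolventSet hC (C' := ‖resolvent T z‖) ?_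
  rw [Complex.conj_conj]
  exact (isResolventAt_resolvent hz).inverseBound

/-- The inverse bounds at `z` and `conj z` persist under small shifts, so one can step off the real
axis. A nonreal base point is needed because estimates will be wanted near every real point. -/
theorem IsSelfAdjointOp.exists_im_ne_zero (hT : IsSelfAdjointOp K T)
    (hne : (resolventSet T).Nonempty) : ∃ w ∈ resolventSet T, w.im ≠ 0 := by
  obtain ⟨z, hz⟩ := hne
  obtain ⟨C, -, hC⟩ := eventually_inverseBound hz
  obtain ⟨C', -, hC'⟩ := eventually_inverseBound (hT.conj_mem_resolventSet hz)
  have h1 : Filter.Tendsto (fun t : ℝ => z + t * Complex.I) (nhds 0) (nhds z) := by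
    have : Continuous fun t : ℝ => z + t * Complex.I := by fun_prop
    simpa using this.tendsto 0
  have h2 : Filter.Tendsto (fun t : ℝ => conj (z + t * Complex.I)) (nhds 0) (nhds (conj z)) :=
    (Complex.continuous_conj.tendsto z).comp h1
  have h3 : ∃ᶠ t : ℝ in nhds 0, (z + t * Complex.I).im ≠ 0 := by
    have h4 : ∀ᶠ t : ℝ in nhdsWithin 0 {0}ᶜ, (z + t * Complex.I).im ≠ 0 := by
      by_cases h : z.im = 0
      · filter_upwards [self_mem_nhdsWithin] with t ht
        simpa [h] using ht
      · have h5 : Filter.Tendsto (fun t : ℝ => (z + t * Complex.I).im) (nhdsWithin 0 {0}ᶜ)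
            (nhds z.im) :=
          ((Complex.continuous_im.tendsto z).comp h1).mono_left nhdsWithin_le_nhds
        exact h5.eventually_ne h
    exact h4.frequently.filter_mono nhdsWithin_le_nhds
  obtain ⟨t, ht, ht1, ht2⟩ := (h3.and_eventually ((h1.eventually hC).and
    (h2.eventually hC'))).exists
  exact ⟨_, hT.mem_resolventSet ht1 ht2, ht⟩

end Basic

/-! ### Positive bounded operators and the Cauchy–Schwarz argument. -/

section Positive

variable {E : Type*} [NormedAddCommGroup E] [NormedSpace ℂ E] {K : KreinStructure E}
  {T : E →ₗ.[ℂ] E} {A : E →L[ℂ] E}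

/-- A bounded operator whose quadratic form for `K` takes nonnegative real values. -/
def IsPositiveBounded (K : KreinStructure E) (A : E →L[ℂ] E) : Prop :=
  ∀ u : E, (K.form u (A u)).im = 0 ∧ 0 ≤ (K.form u (A u)).re

/-- Polarization: reality at `u + v` compares imaginary parts, reality at `u + i v` compares real
parts. -/
theorem IsPositiveBounded.conj_form (hA : IsPositiveBounded K A) (u v : E) :
    conj (K.form v (A u)) = K.form u (A v) := by
  have h1 := (hA (u + v)).1
  have h2 := (hA (u + Complex.I • v)).1
  have hu := (hA u).1
  have hv := (hA v).1
  simp only [map_add, map_smul, map_smulₛₗ, add_apply,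
    smul_apply, Complex.add_im, Complex.conj_I, smul_eq_mul, Complex.mul_im,
    Complex.mul_re, Complex.neg_re, Complex.neg_im, Complex.I_re, Complex.I_im, Complex.add_re]
    at h1 h2
  apply Complex.ext
  · rw [Complex.conj_re]; linarith
  · rw [Complex.conj_im]; linarith

theorem IsPositiveBounded.norm_form_sq_le (hA : IsPositiveBounded K A) (u v : E) :
    ‖K.form u (A v)‖ ^ 2 ≤ (K.form u (A u)).re * (K.form v (A v)).re := by
  let c : PreInnerProductSpace.Core ℂ E :=
    { inner := fun x y => K.form x (A y)
      conj_inner_symm := fun x y => hA.conj_form x y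
      re_inner_nonneg := fun x => (hA x).2
      add_left := fun x y z => by simp
      smul_left := fun x y r => by simp }
  have h := @InnerProductSpace.Core.inner_mul_inner_self_le ℂ E _ _ _ c u v
  have h1 : ‖K.form v (A u)‖ = ‖K.form u (A v)‖ := by
    rw [← hA.conj_form, RCLike.norm_conj]
  calc ‖K.form u (A v)‖ ^ 2 = ‖K.form u (A v)‖ * ‖K.form v (A u)‖ := by rw [h1, sq]
    _ ≤ _ := h

theorem KreinStructure.norm_form_le (K : KreinStructure E) (A : E →L[ℂ] E) (u v : E) :
    ‖K.form u (A v)‖ ≤ ‖K.form‖ * ‖A‖ * ‖u‖ * ‖v‖ := by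
  calc _ ≤ ‖K.form‖ * ‖u‖ * ‖A v‖ := K.form.le_opNorm₂ _ _
    _ ≤ ‖K.form‖ * ‖u‖ * (‖A‖ * ‖v‖) := by gcongr; exact A.le_opNorm v
    _ = _ := by ring

/-- If `T` is symmetric for the positive form defined by `A`, then `A (T - z)⁻¹` is bounded by a
multiple of `|Im z|⁻¹`. -/
theorem IsPositiveBounded.exists_im_mul_norm_le [CompleteSpace E] (hA : IsPositiveBounded K A)
    (hT : ∀ u : T.domain, (K.form u (A (T u))).im = 0) :
    ∃ C : ℝ, 0 ≤ C ∧ ∀ (z : ℂ) (u : T.domain),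
      |z.im| * ‖A u‖ ≤ C * ‖T u - z • (u : E)‖ := by
  obtain ⟨C, hC, hK⟩ := K.exists_norm_le
  refine ⟨C * (‖K.form‖ * ‖A‖), by positivity, fun z u => ?_⟩
  set f := T u - z • (u : E) with hf
  set M := ‖K.form‖ * ‖A‖ with hM
  have hM0 : 0 ≤ M := by positivity
  have hre : ∀ v : E, (K.form v (A v)).re ≤ M * ‖v‖ ^ 2 := fun v => by
    have h1 := (Complex.abs_re_le_norm _).trans (K.norm_form_le A v v)
    calc _ ≤ _ := (le_abs_self _).trans h1
      _ = _ := by ring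
  have ha := (hA u).2
  set a := (K.form u (A u)).re with ha'
  have hb := (hA f).2
  set b := (K.form f (A f)).re with hb'
  -- Both `⟨u, A T u⟩` and `⟨u, A u⟩` are real, so only `z.im` contributes to the imaginary part.
  have h1 : |z.im| * a ≤ ‖K.form u (A f)‖ := by
    have h2 : (K.form u (A f)).im = -(z.im * a) := by
      rw [hf, map_sub, map_sub, map_smul, map_smul, Complex.sub_im, hT u, smul_eq_mul,
        Complex.mul_im, (hA u).1]
      ring
    have h3 := Complex.abs_im_le_norm (K.form u (A f))
    rwa [h2, abs_neg, abs_mul, abs_of_nonneg ha] at h3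
  have h2 : |z.im| ^ 2 * a ≤ b := by
    rcases ha.eq_or_lt with h0 | h0
    · rw [← h0, mul_zero]; exact hb
    · have h3 : (|z.im| * a) ^ 2 ≤ a * b :=
        (pow_le_pow_left₀ (by positivity) h1 2).trans (hA.norm_form_sq_le u f)
      refine le_of_mul_le_mul_left ?_ h0
      calc a * (|z.im| ^ 2 * a) = (|z.im| * a) ^ 2 := by ring
        _ ≤ a * b := h3
  -- A second use of Cauchy–Schwarz passes from the seminorm of `u` to `A u` tested against
  -- arbitrary `v`; the form itself may be degenerate.
  have h3 : ∀ v : E, |z.im| * ‖K.form v (A u)‖ ≤ M * ‖f‖ * ‖v‖ := fun v => by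
    refine le_of_sq_le_sq ?_ (by positivity)
    calc (|z.im| * ‖K.form v (A u)‖) ^ 2 = |z.im| ^ 2 * ‖K.form v (A u)‖ ^ 2 := by ring
      _ ≤ |z.im| ^ 2 * ((K.form v (A v)).re * a) := by
        gcongr
        exact hA.norm_form_sq_le v u
      _ = (K.form v (A v)).re * (|z.im| ^ 2 * a) := by ring
      _ ≤ (M * ‖v‖ ^ 2) * (M * ‖f‖ ^ 2) :=
        mul_le_mul (hre v) (h2.trans (hre f)) (by positivity) (by positivity)
      _ = _ := by ring
  have h4 : ‖((|z.im| : ℝ) : ℂ) • K.form (A u)‖ ≤ M * ‖f‖ := by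
    refine ContinuousLinearMap.opNorm_le_bound _ (by positivity) fun v => ?_
    rw [smul_apply, norm_smul, Complex.norm_real, Real.norm_eq_abs, abs_abs,
      K.hermitian, RCLike.norm_conj]
    exact h3 v
  rw [norm_smul, Complex.norm_real, Real.norm_eq_abs, abs_abs] at h4
  calc |z.im| * ‖A u‖ ≤ |z.im| * (C * ‖K.form (A u)‖) := by gcongr; exact hK _
    _ = C * (|z.im| * ‖K.form (A u)‖) := by ring
    _ ≤ C * (M * ‖f‖) := by gcongr
    _ = _ := by ring

end Positive

/-! ### Polynomials in the resolvents, as operators and as functions of `z`. -/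

section Calculus

variable {E : Type*} [NormedAddCommGroup E] [NormedSpace ℂ E] {T : E →ₗ.[ℂ] E}

/-- The pairs of a bounded operator `A` and a bounded function `q` on `D` such that
`(A - q z) (T - z)⁻¹` is bounded by a multiple of `|Im z|⁻¹` for `z` in `D`. -/
def approxSubalgebra (T : E →ₗ.[ℂ] E) (D : Set ℂ) : Subalgebra ℂ ((E →L[ℂ] E) × (D → ℂ)) where
  carrier := {x | ∃ C : ℝ, 0 ≤ C ∧ ∀ z : D, ‖x.2 z‖ ≤ C ∧ ∀ u : T.domain,
    |(z : ℂ).im| * ‖x.1 u - x.2 z • (u : E)‖ ≤ C * ‖T u - (z : ℂ) • (u : E)‖}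
  add_mem' := by
    rintro x y ⟨C, hC, hx⟩ ⟨C', hC', hy⟩
    refine ⟨C + C', by positivity, fun z => ⟨?_, fun u => ?_⟩⟩
    · exact (norm_add_le _ _).trans (add_le_add (hx z).1 (hy z).1)
    · have h1 : (x + y).1 u - (x + y).2 z • (u : E) =
          (x.1 u - x.2 z • (u : E)) + (y.1 u - y.2 z • (u : E)) := by
        simp only [Prod.fst_add, Prod.snd_add, add_apply, Pi.add_apply,
          add_smul]
        abel
      rw [h1, add_mul]
      refine le_trans ?_ (add_le_add ((hx z).2 u) ((hy z).2 u))
      rw [← mul_add]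
      exact mul_le_mul_of_nonneg_left (norm_add_le _ _) (abs_nonneg _)
  mul_mem' := by
    rintro x y ⟨C, hC, hx⟩ ⟨C', hC', hy⟩
    refine ⟨C * C' + (‖x.1‖ * C' + C' * C), by positivity, fun z => ⟨?_, fun u => ?_⟩⟩
    · have h1 : ‖(x * y).2 z‖ ≤ C * C' := by
        simp only [Prod.snd_mul, Pi.mul_apply, norm_mul]
        exact mul_le_mul (hx z).1 (hy z).1 (norm_nonneg _) hC
      exact h1.trans (le_add_of_nonneg_right (by positivity))
    -- Telescoping the product; the bound on the function `y.2` in the carrier is what controls the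
    -- second term.
    · have h1 : (x * y).1 u - (x * y).2 z • (u : E) =
          x.1 (y.1 u - y.2 z • (u : E)) + y.2 z • (x.1 u - x.2 z • (u : E)) := by
        simp only [Prod.fst_mul, Prod.snd_mul, mul_apply_eq_comp, Pi.mul_apply,
          map_sub, map_smul, smul_sub, smul_smul, mul_comm]
        abel
      have h2 : ‖(x * y).1 u - (x * y).2 z • (u : E)‖ ≤
          ‖x.1‖ * ‖y.1 u - y.2 z • (u : E)‖ + C' * ‖x.1 u - x.2 z • (u : E)‖ := by
        rw [h1]
        refine (norm_add_le _ _).trans (add_le_add (x.1.le_opNorm _) ?_)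
        rw [norm_smul]
        exact mul_le_mul_of_nonneg_right (hy z).1 (norm_nonneg _)
      calc _ ≤ |(z : ℂ).im| * (‖x.1‖ * ‖y.1 u - y.2 z • (u : E)‖ +
              C' * ‖x.1 u - x.2 z • (u : E)‖) := mul_le_mul_of_nonneg_left h2 (abs_nonneg _)
        _ = ‖x.1‖ * (|(z : ℂ).im| * ‖y.1 u - y.2 z • (u : E)‖) +
              C' * (|(z : ℂ).im| * ‖x.1 u - x.2 z • (u : E)‖) := by ring
        _ ≤ ‖x.1‖ * (C' * ‖T u - (z : ℂ) • (u : E)‖) +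
              C' * (C * ‖T u - (z : ℂ) • (u : E)‖) := by
          exact add_le_add (mul_le_mul_of_nonneg_left ((hy z).2 u) (norm_nonneg _))
            (mul_le_mul_of_nonneg_left ((hx z).2 u) hC')
        _ ≤ _ := by
          have : 0 ≤ C * C' * ‖T u - (z : ℂ) • (u : E)‖ := by positivity
          linarith
  algebraMap_mem' := fun r => ⟨‖r‖, norm_nonneg r, fun z => ⟨le_rfl, fun u => by
    have h1 : ((algebraMap ℂ ((E →L[ℂ] E) × (D → ℂ))) r).1 u -
        ((algebraMap ℂ ((E →L[ℂ] E) × (D → ℂ))) r).2 z • (u : E) = 0 := sub_self _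
    rw [h1, norm_zero, mul_zero]
    positivity⟩⟩

/-- By the resolvent identity, `S - (z - w)⁻¹ = -(z - w)⁻¹ S (T - z)`, and `|Im z| / |z - w|` stays
bounded when `z` keeps away from `w`, even for large `z`. -/
theorem IsResolventAt.mem_approxSubalgebra {w : ℂ} {S : E →L[ℂ] E} (hS : IsResolventAt T w S)
    {D : Set ℂ} {δ : ℝ} (hδ : 0 < δ) (hD : ∀ z ∈ D, δ ≤ ‖z - w‖) :
    ((S, fun z => ((z : ℂ) - w)⁻¹) : (E →L[ℂ] E) × (D → ℂ)) ∈ approxSubalgebra T D := by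
  refine ⟨δ⁻¹ + (1 + |w.im| / δ) * ‖S‖, by positivity, fun z => ⟨?_, fun u => ?_⟩⟩
  · rw [norm_inv]
    have h1 : ‖(z : ℂ) - w‖⁻¹ ≤ δ⁻¹ := inv_anti₀ hδ (hD z z.2)
    exact h1.trans (le_add_of_nonneg_right (by positivity))
  · have hz : δ ≤ ‖(z : ℂ) - w‖ := hD z z.2
    have hz0 : (z : ℂ) - w ≠ 0 := norm_pos_iff.1 (hδ.trans_le hz)
    have h1 : S u - ((z : ℂ) - w)⁻¹ • (u : E) =
        -(((z : ℂ) - w)⁻¹ • S (T u - (z : ℂ) • (u : E))) := by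
      have h2 : T u - (z : ℂ) • (u : E) = (T u - w • (u : E)) - ((z : ℂ) - w) • (u : E) := by
        rw [sub_smul]; abel
      rw [h2, map_sub, hS.2, map_smul, smul_sub, inv_smul_smul₀ hz0]
      abel
    have h2 : |(z : ℂ).im| ≤ (1 + |w.im| / δ) * ‖(z : ℂ) - w‖ := by
      have h3 : |(z : ℂ).im| ≤ |((z : ℂ) - w).im| + |w.im| := by
        rw [Complex.sub_im]
        simpa using abs_add_le ((z : ℂ).im - w.im) w.im
      have h4 : |w.im| ≤ |w.im| / δ * ‖(z : ℂ) - w‖ := by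
        rw [div_mul_eq_mul_div, le_div_iff₀ hδ]
        exact mul_le_mul_of_nonneg_left hz (abs_nonneg _)
      linarith [Complex.abs_im_le_norm ((z : ℂ) - w)]
    change |(z : ℂ).im| * ‖S u - ((z : ℂ) - w)⁻¹ • (u : E)‖ ≤ _
    rw [h1, norm_neg, norm_smul, norm_inv, ← mul_assoc]
    have h3 : |(z : ℂ).im| * ‖(z : ℂ) - w‖⁻¹ ≤ 1 + |w.im| / δ := by
      rw [← div_eq_mul_inv, div_le_iff₀ (hδ.trans_le hz)]
      exact h2
    calc _ ≤ (1 + |w.im| / δ) * (‖S‖ * ‖T u - (z : ℂ) • (u : E)‖) := by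
          gcongr
          exact S.le_opNorm _
      _ ≤ _ := by
        have : 0 ≤ δ⁻¹ * ‖T u - (z : ℂ) • (u : E)‖ := by positivity
        linarith

theorem IsResolventAt.sub_eq {w w' : ℂ} {S S' : E →L[ℂ] E} (hS : IsResolventAt T w S)
    (hS' : IsResolventAt T w' S') : S - S' = (w - w') • (S * S') := by
  ext x
  obtain ⟨hx, hSx⟩ := hS'.1 x
  have h1 := hS.2 ⟨S' x, hx⟩
  have h2 : T ⟨S' x, hx⟩ - w • S' x = x - (w - w') • S' x := by
    calc _ = (T ⟨S' x, hx⟩ - w' • S' x) - (w - w') • S' x := by rw [sub_smul]; abel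
      _ = _ := by rw [hSx]
  simp only [h2, map_sub, map_smul] at h1
  simp only [sub_apply, smul_apply,
    mul_apply_eq_comp]
  rw [sub_eq_iff_eq_add, add_comm, ← sub_eq_iff_eq_add]
  exact h1

theorem IsResolventAt.mul_comm {w w' : ℂ} (hw : w ≠ w') {S S' : E →L[ℂ] E}
    (hS : IsResolventAt T w S) (hS' : IsResolventAt T w' S') : S * S' = S' * S := by
  have h1 := hS.sub_eq hS'
  have h2 := hS'.sub_eq hS
  rw [← neg_sub, h1, ← neg_sub w w', neg_smul, neg_inj] at h2
  exact smul_right_injective _ (sub_ne_zero.2 hw) h2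

theorem IsResolventAt.apply_eq {w : ℂ} {S : E →L[ℂ] E} (hS : IsResolventAt T w S) (x : E) :
    ∃ h : S x ∈ T.domain, T ⟨S x, h⟩ = (1 + w • S) x := by
  obtain ⟨h, hx⟩ := hS.1 x
  exact ⟨h, sub_eq_iff_eq_add.1 hx⟩

theorem IsResolventAt.opPow_apply {w : ℂ} {S : E →L[ℂ] E} (hS : IsResolventAt T w S) (k : ℕ)
    (x : E) : ∃ h : (S ^ k) x ∈ (opPow T k).domain,
      opPow T k ⟨(S ^ k) x, h⟩ = ((1 + w • S) ^ k) x := by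
  induction k generalizing x with
  | zero => exact ⟨trivial, rfl⟩
  | succ k ih =>
    obtain ⟨h1, h2⟩ := ih (S x)
    obtain ⟨h3, h4⟩ := hS.apply_eq (((1 + w • S) ^ k) x)
    have hc : Commute ((1 + w • S) ^ k) S :=
      (((Commute.one_left S).add_left ((Commute.refl S).smul_left w)).pow_left k)
    have h5 : opPow T k ⟨(S ^ k) (S x), h1⟩ = S (((1 + w • S) ^ k) x) := by
      rw [h2]
      exact DFunLike.congr_fun hc.eq x
    have h6 : (S ^ (k + 1)) x = (S ^ k) (S x) := by rw [pow_succ]; rfl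
    have h7 : (S ^ (k + 1)) x ∈ (opPow T (k + 1)).domain := by
      rw [h6]
      exact mem_opComp_domain.2 ⟨h1, h5 ▸ h3⟩
    refine ⟨h7, ?_⟩
    have h8 : (⟨(S ^ (k + 1)) x, (mem_opComp_domain.1 h7).1⟩ : (opPow T k).domain) = ⟨_, h1⟩ :=
      Subtype.ext h6
    have h9 : opPow T (k + 1) ⟨(S ^ (k + 1)) x, h7⟩ = T ⟨S (((1 + w • S) ^ k) x), h3⟩ :=
      congrArg (fun v => T v) (Subtype.ext ((congrArg (fun v => opPow T k v) h8).trans h5))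
    rw [h9, h4, pow_succ']
    rfl

/-- Since `T S = 1 + w S`, each `T ^ k S ^ n` equals `(T S) ^ k S ^ (n - k)`; this makes `p(T) S ^
n` a bounded operator, polynomial in `S`. -/
theorem IsResolventAt.opPoly_apply {w : ℂ} {S : E →L[ℂ] E} (hS : IsResolventAt T w S)
    (p : ℝ[X]) (x : E) : ∃ h : (S ^ p.natDegree) x ∈ (opPoly T p).domain,
      opPoly T p ⟨(S ^ p.natDegree) x, h⟩ = (∑ k : Fin (p.natDegree + 1), ((p.coeff k : ℝ) : ℂ) •
        ((1 + w • S) ^ (k : ℕ) * S ^ (p.natDegree - k))) x := by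
  obtain ⟨h, -⟩ := hS.opPow_apply p.natDegree x
  refine ⟨h, ?_⟩
  rw [KreinResolvent.opPoly_apply, sum_apply]
  refine Finset.sum_congr rfl fun k _ => ?_
  rw [smul_apply, mul_apply_eq_comp]
  congr 1
  obtain ⟨h1, h2⟩ := hS.opPow_apply k ((S ^ (p.natDegree - k)) x)
  rw [← h2]
  congr 1
  refine Subtype.ext ?_
  change (S ^ p.natDegree) x = (S ^ (k : ℕ)) ((S ^ (p.natDegree - k)) x)
  rw [← mul_apply_eq_comp, ← pow_add, Nat.add_sub_cancel' (Nat.lt_succ_iff.1 k.2)]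

theorem IsResolventAt.denseRange {w : ℂ} {S : E →L[ℂ] E} (hS : IsResolventAt T w S)
    (hT : Dense (T.domain : Set E)) : DenseRange S :=
  hT.mono fun u hu => ⟨_, hS.2 ⟨u, hu⟩⟩

theorem denseRange_pow {S : E →L[ℂ] E} (hS : DenseRange S) (n : ℕ) : DenseRange (S ^ n) := by
  induction n with
  | zero => exact Function.surjective_id.denseRange
  | succ n ih =>
    rw [pow_succ]
    exact ih.comp hS (S ^ n).continuous

end Calculus

/-! ### The algebraic identity behind the definition of `A`. -/

section Ring

variable {R : Type*} [CommRing R] [Algebra ℂ R]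

/-- If `s = (x - w)⁻¹` and `s' = (x - w')⁻¹`, the quotient of a polynomial of degree at most
`n ≤ 2 m` in `x` by `(x - w) ^ m * (x - w') ^ m` is a polynomial in `s` and `s'`. -/
theorem exists_mul_pow_eq {w w' : ℂ} {s s' : R} (h : s - s' = (w - w') • (s * s')) {n m : ℕ}
    (hn : n ≤ 2 * m) (a : Fin (n + 1) → ℂ) :
    ∃ α : R, α * s ^ n = s ^ m * s' ^ m *
      ∑ k : Fin (n + 1), a k • ((1 + w • s) ^ (k : ℕ) * s ^ (n - k)) := by
  -- Both sides stand for `x s s'`, as `1 + w s` stands for `x s`. The element `s` need not be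
  -- cancellable, so the identity sought keeps the factor `s ^ n`.
  have hb : (1 + w' • s') * s = (1 + w • s) * s' := by
    rw [Algebra.smul_def, map_sub] at h
    rw [Algebra.smul_def, Algebra.smul_def]
    linear_combination h
  set b := 1 + w • s
  set b' := 1 + w' • s'
  clear_value b b'
  have key : ∀ k i : ℕ, k + i = n → ∃ α : R, α * s ^ n = s ^ m * s' ^ m * (b ^ k * s ^ i) := by
    rintro k i rfl
    rcases le_total k m with hk | hk
    · obtain ⟨j, rfl⟩ := Nat.exists_eq_add_of_le hk
      exact ⟨b ^ k * s ^ j * s' ^ (k + j), by ring⟩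
    · obtain ⟨j, rfl⟩ := Nat.exists_eq_add_of_le hk
      obtain ⟨l, rfl⟩ := Nat.exists_eq_add_of_le (show j ≤ m by omega)
      -- Here `m = j + l` and `k = m + j`: the numerator `x ^ k` is split between the `m` factors
      -- `s` and `j` of the `m` factors `s'`.
      refine ⟨b ^ (j + l) * b' ^ j * s' ^ l, ?_⟩
      calc b ^ (j + l) * b' ^ j * s' ^ l * s ^ (j + l + j + i) =
          b ^ (j + l) * s ^ (j + l) * s ^ i * s' ^ l * (b' * s) ^ j := by ring
        _ = _ := by rw [hb]; ring
  choose α hα using fun k : Fin (n + 1) =>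
    key k (n - k) (Nat.add_sub_cancel' (Nat.lt_succ_iff.1 k.2))
  refine ⟨∑ k, a k • α k, ?_⟩
  rw [Finset.sum_mul, Finset.mul_sum]
  refine Finset.sum_congr rfl fun k _ => ?_
  rw [smul_mul_assoc, hα, mul_smul_comm]

end Ring

/-! ### Transfer to the subalgebra generated by two commuting elements. -/

section Adjoin

variable {R : Type*} [Ring R] [Algebra ℂ R]

theorem commute_of_mem_adjoin_pair {s s' : R} (hs : s * s' = s' * s) {a b : R}
    (ha : a ∈ Algebra.adjoin ℂ {s, s'}) (hb : b ∈ Algebra.adjoin ℂ {s, s'}) : a * b = b * a := by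
  have : IsMulCommutative (Algebra.adjoin ℂ {s, s'}) := Algebra.isMulCommutative_adjoin ℂ (by
    rintro x (rfl | rfl) y (rfl | rfl)
    exacts [rfl, hs, hs.symm, rfl])
  exact setLike_mul_comm ha hb

open scoped IsMulCommutative in
theorem exists_mem_adjoin_mul_pow_eq {w w' : ℂ} {s s' : R} (hs : s * s' = s' * s)
    (h : s - s' = (w - w') • (s * s')) {n m : ℕ} (hn : n ≤ 2 * m) (a : Fin (n + 1) → ℂ) :
    ∃ α ∈ Algebra.adjoin ℂ {s, s'}, α * s ^ n = s ^ m * s' ^ m *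
      ∑ k : Fin (n + 1), a k • ((1 + w • s) ^ (k : ℕ) * s ^ (n - k)) := by
  have : IsMulCommutative (Algebra.adjoin ℂ {s, s'}) := Algebra.isMulCommutative_adjoin ℂ (by
    rintro x (rfl | rfl) y (rfl | rfl)
    exacts [rfl, hs, hs.symm, rfl])
  let t : Algebra.adjoin ℂ {s, s'} := ⟨s, Algebra.subset_adjoin (by simp)⟩
  let t' : Algebra.adjoin ℂ {s, s'} := ⟨s', Algebra.subset_adjoin (by simp)⟩
  obtain ⟨α, hα⟩ := exists_mul_pow_eq (s := t) (s' := t') (w := w) (w' := w') (Subtype.ext h) hn a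
  refine ⟨α, α.2, ?_⟩
  have h1 := congrArg (Algebra.adjoin ℂ {s, s'}).val hα
  simp only [map_mul, map_pow, map_sum, map_smul, map_add, map_one] at h1
  exact h1

end Adjoin

/-! ### The weighted resolvent bound from a definitizing polynomial. -/

section Definitizing

variable {E : Type*} [NormedAddCommGroup E] [NormedSpace ℂ E] {K : KreinStructure E}
  {T : E →ₗ.[ℂ] E}

theorem form_pow_apply {S S' : E →L[ℂ] E} (h : ∀ u v, K.form (S' u) v = K.form u (S v)) (m : ℕ)
    (u v : E) : K.form ((S' ^ m) u) v = K.form u ((S ^ m) v) := by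
  induction m generalizing u v with
  | zero => rfl
  | succ m ih =>
    rw [pow_succ, pow_succ', mul_apply_eq_comp, mul_apply_eq_comp, ih, h]

theorem IsPositiveBounded.of_denseRange {A P : E →L[ℂ] E} (hP : DenseRange P)
    (h : ∀ y, (K.form (P y) (A (P y))).im = 0 ∧ 0 ≤ (K.form (P y) (A (P y))).re) :
    IsPositiveBounded K A := fun u => by
  have hc : Continuous fun u => K.form u (A u) := K.form.continuous.clm_apply A.continuous
  refine hP.induction_on u ?_ h
  exact (isClosed_eq (Complex.continuous_im.comp hc) continuous_const).inter
    (isClosed_le continuous_const (Complex.continuous_re.comp hc))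

/-- Commuting with a resolvent, `A` preserves `Dom T` and commutes with `T` there, so `⟨T u, A u⟩ =
⟨u, T A u⟩ = ⟨u, A T u⟩`; symmetry of `A` identifies the left side with the conjugate of the right.
-/
theorem IsSelfAdjointOp.form_im_eq_zero (hT : IsSelfAdjointOp K T) {A S : E →L[ℂ] E} {w : ℂ}
    (hS : IsResolventAt T w S) (hA : IsPositiveBounded K A) (hAS : A * S = S * A)
    (u : T.domain) : (K.form u (A (T u))).im = 0 := by
  obtain ⟨y, rfl⟩ : ∃ y, u = ⟨S y, (hS.1 y).1⟩ :=
    ⟨T u - w • (u : E), Subtype.ext (hS.2 u).symm⟩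
  obtain ⟨h1, h2⟩ := hS.apply_eq y
  obtain ⟨h3, h4⟩ := hS.apply_eq (A y)
  have hASx : ∀ x, A (S x) = S (A x) := fun x => DFunLike.congr_fun hAS x
  have h5 : A (T ⟨S y, h1⟩) = T ⟨S (A y), h3⟩ := by
    rw [h2, h4]
    simp [hASx]
  have h6 : conj (K.form (S y) (A (T ⟨S y, h1⟩))) = K.form (S y) (A (T ⟨S y, h1⟩)) := by
    have h7 := hA.conj_form (T ⟨S y, h1⟩) (S y)
    rw [h7, hASx, hT.form_apply ⟨S y, h1⟩ ⟨S (A y), h3⟩, h5]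
  exact Complex.conj_eq_iff_im.1 h6

/-- The central estimate: `q(z) u = A u - (A u - q(z) u)`, with the first term controlled by
positivity and the second by the functional calculus. Leaving `m` free allows the optimal choice at
infinity. -/
theorem IsSelfAdjointOp.exists_definitizing_bound [CompleteSpace E] (hT : IsSelfAdjointOp K T)
    {w : ℂ} (hw : w ∈ resolventSet T) (him : w.im ≠ 0) {p : ℝ[X]} (hp : IsDefinitizing K T p)
    {m : ℕ} (hm : p.natDegree ≤ 2 * m) {δ : ℝ} (hδ : 0 < δ) :
    ∃ C : ℝ, 0 ≤ C ∧ ∀ z : ℂ, δ ≤ ‖z - w‖ → δ ≤ ‖z - conj w‖ → ∀ u : T.domain,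
      |z.im| * (‖Polynomial.aeval z p‖ * ‖(u : E)‖) ≤
        C * ‖(z - w) * (z - conj w)‖ ^ m * ‖T u - z • (u : E)‖ := by
  have hS := isResolventAt_resolvent hw
  have hS' := isResolventAt_resolvent (hT.conj_mem_resolventSet hw)
  set S := resolvent T w
  set S' := resolvent T (conj w)
  have hww : w ≠ conj w := fun h => him (Complex.conj_eq_iff_im.1 h.symm)
  have hSS := hS.mul_comm hww hS'
  set D : Set ℂ := {z | δ ≤ ‖z - w‖ ∧ δ ≤ ‖z - conj w‖} with hD
  have hDw : ∀ z : D, (z : ℂ) - w ≠ 0 := fun z => norm_pos_iff.1 (hδ.trans_le z.2.1)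
  have hDw' : ∀ z : D, (z : ℂ) - conj w ≠ 0 := fun z => norm_pos_iff.1 (hδ.trans_le z.2.2)
  -- In the product algebra, one element `α` supplies both `A` and the function `q`, built by the
  -- same polynomial in the resolvents.
  set σ : (E →L[ℂ] E) × (D → ℂ) := (S, fun z => ((z : ℂ) - w)⁻¹) with hσ
  set σ' : (E →L[ℂ] E) × (D → ℂ) := (S', fun z => ((z : ℂ) - conj w)⁻¹) with hσ'
  have hσσ : σ * σ' = σ' * σ := Prod.ext hSS (funext fun z => mul_comm _ _)
  have hσsub : σ - σ' = (w - conj w) • (σ * σ') := by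
    refine Prod.ext (hS.sub_eq hS') (funext fun z => ?_)
    have h1 := hDw z
    have h2 := hDw' z
    change ((z : ℂ) - w)⁻¹ - ((z : ℂ) - conj w)⁻¹ =
      (w - conj w) * (((z : ℂ) - w)⁻¹ * ((z : ℂ) - conj w)⁻¹)
    field_simp
    ring
  obtain ⟨α, hα, hαeq⟩ := exists_mem_adjoin_mul_pow_eq hσσ hσsub hm
    fun k => ((p.coeff k : ℝ) : ℂ)
  have hle : Algebra.adjoin ℂ {σ, σ'} ≤ approxSubalgebra T D := by
    refine Algebra.adjoin_le ?_
    rintro x (rfl | rfl)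
    · exact hS.mem_approxSubalgebra hδ fun z hz => hz.1
    · exact hS'.mem_approxSubalgebra hδ fun z hz => hz.2
  have hσmem : σ ∈ Algebra.adjoin ℂ {σ, σ'} := Algebra.subset_adjoin (by simp)
  have hσmem' : σ' ∈ Algebra.adjoin ℂ {σ, σ'} := Algebra.subset_adjoin (by simp)
  set π := ∑ k : Fin (p.natDegree + 1), ((p.coeff k : ℝ) : ℂ) •
    ((1 + w • σ) ^ (k : ℕ) * σ ^ (p.natDegree - k)) with hπ
  have hπmem : π ∈ Algebra.adjoin ℂ {σ, σ'} :=
    sum_mem fun k _ => Subalgebra.smul_mem _ (mul_mem (pow_mem (add_mem (one_mem _)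
      (Subalgebra.smul_mem _ hσmem _)) _) (pow_mem hσmem _)) _
  have hπ1 : π.1 = ∑ k : Fin (p.natDegree + 1), ((p.coeff k : ℝ) : ℂ) •
      ((1 + w • S) ^ (k : ℕ) * S ^ (p.natDegree - k)) := by
    rw [hπ, Prod.fst_sum]
    rfl
  have hAS : α.1 * S = S * α.1 :=
    congrArg Prod.fst (commute_of_mem_adjoin_pair hσσ hα hσmem)
  have hπS : π.1 * S' ^ m = S' ^ m * π.1 :=
    congrArg Prod.fst (commute_of_mem_adjoin_pair hσσ hπmem (pow_mem hσmem' m))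
  have hSSn : S' ^ m * S ^ p.natDegree = S ^ p.natDegree * S' ^ m :=
    congrArg Prod.fst
      (commute_of_mem_adjoin_pair hσσ (pow_mem hσmem' m) (pow_mem hσmem p.natDegree))
  have hA1 : α.1 * S ^ p.natDegree = S ^ m * S' ^ m * π.1 := congrArg Prod.fst hαeq
  -- On the dense range of `S ^ n`, moving `S ^ m` across the form gives `⟨S ^ n y, A S ^ n y⟩ = ⟨x,
  -- p(T) x⟩` with `x = S ^ n S' ^ m y`.
  have hpos : IsPositiveBounded K α.1 := by
    refine .of_denseRange (denseRange_pow (hS.denseRange hT.1) p.natDegree) fun y => ?_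
    obtain ⟨h1, h2⟩ := hS.opPoly_apply p ((S' ^ m) y)
    rw [← hπ1] at h2
    have h3 : K.form ((S ^ p.natDegree) y) (α.1 ((S ^ p.natDegree) y)) =
        K.form ((S ^ p.natDegree) ((S' ^ m) y)) (π.1 ((S' ^ m) y)) := by
      have h4 := DFunLike.congr_fun hA1 y
      have h5 := DFunLike.congr_fun hπS y
      have h6 := DFunLike.congr_fun hSSn y
      simp only [mul_apply_eq_comp] at h4 h5 h6
      rw [h4, h5, ← h6, ← form_pow_apply (hT.form_resolvent hS hS')]
    rw [h3, ← h2]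
    exact hp.2 ⟨_, h1⟩
  obtain ⟨C, hC, hA⟩ := hpos.exists_im_mul_norm_le (hT.form_im_eq_zero hS hpos hAS)
  obtain ⟨C', hC', hq⟩ := hle hα
  refine ⟨C + C', by positivity, fun z hz hz' u => ?_⟩
  have hα2 : α.2 ⟨z, hz, hz'⟩ * ((z - w) * (z - conj w)) ^ m = Polynomial.aeval z p := by
    have h1 := congrFun (congrArg Prod.snd hαeq) ⟨z, hz, hz'⟩
    have h2 : α.2 ⟨z, hz, hz'⟩ * (z - w)⁻¹ ^ p.natDegree = (z - w)⁻¹ ^ m * (z - conj w)⁻¹ ^ m *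
        π.2 ⟨z, hz, hz'⟩ := h1
    have hzw : z - w ≠ 0 := hDw ⟨z, hz, hz'⟩
    have hzw' : z - conj w ≠ 0 := hDw' ⟨z, hz, hz'⟩
    have h3 : π.2 ⟨z, hz, hz'⟩ = Polynomial.aeval z p * (z - w)⁻¹ ^ p.natDegree := by
      rw [hπ, Prod.snd_sum, Finset.sum_apply, Polynomial.aeval_eq_sum_range,
        ← Fin.sum_univ_eq_sum_range (fun k => p.coeff k • z ^ k), Finset.sum_mul]
      refine Finset.sum_congr rfl fun k _ => ?_
      change ((p.coeff k : ℝ) : ℂ) * ((1 + w * (z - w)⁻¹) ^ (k : ℕ) *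
        (z - w)⁻¹ ^ (p.natDegree - k)) = _
      have h4 : 1 + w * (z - w)⁻¹ = z * (z - w)⁻¹ := by
        field_simp
        ring
      rw [h4, mul_pow, mul_assoc (z ^ (k : ℕ)), ← pow_add,
        Nat.add_sub_cancel' (Nat.lt_succ_iff.1 k.2), Complex.real_smul, mul_assoc]
    rw [h3, ← mul_assoc] at h2
    have h4 := mul_right_cancel₀ (pow_ne_zero _ (inv_ne_zero hzw)) h2
    rw [h4, mul_pow, inv_pow, inv_pow]
    field_simp
  have h1 := hA z u
  have h2 := (hq ⟨z, hz, hz'⟩).2 u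
  have h3 : |z.im| * (‖α.2 ⟨z, hz, hz'⟩‖ * ‖(u : E)‖) ≤ (C + C') * ‖T u - z • (u : E)‖ := by
    rw [← norm_smul, add_mul]
    refine le_trans ?_ (add_le_add h1 h2)
    rw [← mul_add]
    refine mul_le_mul_of_nonneg_left ?_ (abs_nonneg _)
    rw [add_comm]
    exact (norm_le_norm_sub_add _ _).trans_eq (by rw [norm_sub_rev])
  rw [← hα2, norm_mul, norm_pow]
  calc _ = ‖(z - w) * (z - conj w)‖ ^ m *
        (|z.im| * (‖α.2 ⟨z, hz, hz'⟩‖ * ‖(u : E)‖)) := by ring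
    _ ≤ ‖(z - w) * (z - conj w)‖ ^ m * ((C + C') * ‖T u - z • (u : E)‖) := by gcongr
    _ = _ := by ring

/-- The resolvent set contains every nonreal number that is not a zero of a definitizing
polynomial. -/
theorem IsSelfAdjointOp.mem_resolventSet_of_aeval_ne_zero [CompleteSpace E]
    (hT : IsSelfAdjointOp K T) (hne : (resolventSet T).Nonempty) {p : ℝ[X]}
    (hp : IsDefinitizing K T p) {z : ℂ} (hz : z.im ≠ 0) (hpz : Polynomial.aeval z p ≠ 0) :
    z ∈ resolventSet T := by
  obtain ⟨w, hw, him⟩ := hT.exists_im_ne_zero hne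
  by_cases hzw : z = w
  · rwa [hzw]
  by_cases hzw' : z = conj w
  · rw [hzw']
    exact hT.conj_mem_resolventSet hw
  have key : ∀ z : ℂ, z.im ≠ 0 → Polynomial.aeval z p ≠ 0 → z ≠ w → z ≠ conj w →
      ∃ C, InverseBound T z C := by
    intro z hz hpz h1 h2
    obtain ⟨C, hC, h⟩ := hT.exists_definitizing_bound hw him hp (m := p.natDegree) (by omega)
      (lt_min (norm_pos_iff.2 (sub_ne_zero.2 h1)) (norm_pos_iff.2 (sub_ne_zero.2 h2)))
    refine ⟨C * ‖(z - w) * (z - conj w)‖ ^ p.natDegree / (|z.im| * ‖Polynomial.aeval z p‖),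
      fun u => ?_⟩
    have h3 := h z (min_le_left _ _) (min_le_right _ _) u
    rw [div_mul_eq_mul_div, le_div_iff₀ (by positivity)]
    linarith
  obtain ⟨C, hC⟩ := key z hz hpz hzw hzw'
  -- As `p` is real, it does not vanish at `conj z` either.
  obtain ⟨C', hC'⟩ := key (conj z) (by simpa using hz)
    (by rw [Polynomial.aeval_conj]; simpa using hpz)
    (fun h => hzw' (by rw [← h, Complex.conj_conj]))
    (fun h => hzw ((starRingEnd ℂ).injective h))
  exact hT.mem_resolventSet hC hC'

end Definitizing

/-! ### Local estimates at finite points and at infinity. -/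

section Order

variable {E : Type*} [NormedAddCommGroup E] [NormedSpace ℂ E] {K : KreinStructure E}
  {T : E →ₗ.[ℂ] E}

theorem IsDefinitizable.exists_polyOrder_eq (hT : IsDefinitizable K T) (ω : OnePoint ℂ) :
    ∃ p : ℝ[X], IsDefinitizing K T p ∧ polyOrder p ω = orderFun K T ω := by
  obtain ⟨p, hp⟩ := hT.exists_definitizing
  exact Nat.sInf_mem (s := {k | ∃ p : ℝ[X], IsDefinitizing K T p ∧ polyOrder p ω = k})
    ⟨_, p, hp, rfl⟩

theorem orderFun_le {p : ℝ[X]} (hp : IsDefinitizing K T p) (ω : OnePoint ℂ) :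
    orderFun K T ω ≤ polyOrder p ω :=
  Nat.sInf_le ⟨p, hp, rfl⟩

theorem polyOrder_infty (p : ℝ[X]) : polyOrder p ∞ = if Even p.natDegree then 0 else 1 := rfl

theorem polyOrder_coe (p : ℝ[X]) (ξ : ℂ) :
    polyOrder p ξ = (p.map (algebraMap ℝ ℂ)).rootMultiplicity ξ := rfl

theorem finite_setOf_aeval_eq_zero {p : ℝ[X]} (hp : p ≠ 0) :
    {z : ℂ | Polynomial.aeval z p = 0}.Finite := by
  refine (Polynomial.finite_setOfPred_isRoot (p := p.map (algebraMap ℝ ℂ))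
    ((Polynomial.map_ne_zero_iff (algebraMap ℝ ℂ).injective).2 hp)).subset fun z hz => ?_
  change Polynomial.eval z _ = 0
  rwa [Polynomial.eval_map_algebraMap]

theorem finite_realCriticalPoints {p : ℝ[X]} (hp : IsDefinitizing K T p) :
    (realCriticalPoints K T).Finite := by
  refine Set.Finite.of_finite_image (f := fun x : ℝ => (x : ℂ))
    ((finite_setOf_aeval_eq_zero hp.1).subset ?_) Complex.ofReal_injective.injOn
  rintro _ ⟨ξ, hξ, rfl⟩
  have h1 : (p.map (algebraMap ℝ ℂ)).rootMultiplicity (ξ : ℂ) ≠ 0 := fun h0 =>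
    hξ (Nat.le_zero.1 ((orderFun_le hp _).trans_eq (by rw [polyOrder_coe, h0])))
  have h2 := (Polynomial.rootMultiplicity_pos'.1 (Nat.pos_of_ne_zero h1)).2
  change Polynomial.aeval (ξ : ℂ) p = 0
  rwa [Polynomial.IsRoot, Polynomial.eval_map_algebraMap] at h2

/-- The lower bound for the modulus of a polynomial near a zero. -/
theorem exists_pow_le_norm_aeval {p : ℝ[X]} (hp : p ≠ 0) (ω : ℂ) :
    ∃ c : ℝ, 0 < c ∧ ∀ᶠ z in nhds ω,
      c * ‖z - ω‖ ^ (polyOrder p ω) ≤ ‖Polynomial.aeval z p‖ := by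
  have hp' : p.map (algebraMap ℝ ℂ) ≠ 0 :=
    (Polynomial.map_ne_zero_iff (algebraMap ℝ ℂ).injective).2 hp
  obtain ⟨g, hg, hgω⟩ := Polynomial.exists_eq_pow_rootMultiplicity_mul_and_not_dvd _ hp' ω
  rw [Polynomial.dvd_iff_isRoot] at hgω
  have hpos : 0 < ‖g.eval ω‖ := norm_pos_iff.2 hgω
  refine ⟨‖g.eval ω‖ / 2, by positivity, ?_⟩
  have hc : Continuous fun z => ‖g.eval z‖ := g.continuous.norm
  filter_upwards [hc.tendsto ω |>.eventually (lt_mem_nhds (half_lt_self hpos))] with z hz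
  rw [← Polynomial.eval_map_algebraMap, hg, polyOrder_coe, Polynomial.eval_mul,
    Polynomial.eval_pow, Polynomial.eval_sub, Polynomial.eval_X, Polynomial.eval_C, norm_mul,
    norm_pow, mul_comm]
  exact mul_le_mul_of_nonneg_left hz.le (by positivity)

/-- The lower bound for the modulus of a polynomial near infinity. -/
theorem exists_pow_le_norm_aeval_cobounded {p : ℝ[X]} (hp : p ≠ 0) :
    ∃ c : ℝ, 0 < c ∧ ∀ᶠ z in Bornology.cobounded ℂ,
      c * ‖z‖ ^ p.natDegree ≤ ‖Polynomial.aeval z p‖ := by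
  have hpos : 0 < |p.leadingCoeff| := abs_pos.2 (Polynomial.leadingCoeff_ne_zero.2 hp)
  refine ⟨|p.leadingCoeff| / 2, by positivity, ?_⟩
  -- The reversed polynomial moves infinity to `0`, where its value is the leading coefficient.
  have h1 : Filter.Tendsto (fun z : ℂ => ‖Polynomial.aeval z⁻¹ p.reverse‖)
      (Bornology.cobounded ℂ) (nhds |p.leadingCoeff|) := by
    have h2 : Continuous fun z : ℂ => ‖Polynomial.aeval z p.reverse‖ :=
      (Polynomial.continuous_aeval _).norm
    have h3 := (h2.tendsto 0).comp (Filter.tendsto_inv₀_cobounded (α := ℂ))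
    have h4 : ‖Polynomial.aeval (0 : ℂ) p.reverse‖ = |p.leadingCoeff| := by
      rw [← Polynomial.coeff_zero_eq_aeval_zero', Polynomial.coeff_zero_reverse]
      simp
    rwa [h4] at h3
  filter_upwards [h1.eventually (lt_mem_nhds (half_lt_self hpos)),
    Bornology.eventually_ne_cobounded 0] with z hz hz0
  have := invertibleOfNonzero hz0
  have h5 := Polynomial.eval₂_reverse_mul_pow (algebraMap ℝ ℂ) z p
  rw [invOf_eq_inv] at h5
  rw [Polynomial.aeval_def, ← h5, norm_mul, norm_pow]
  exact mul_le_mul_of_nonneg_right hz.le (by positivity)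

variable [CompleteSpace E]

theorem IsDefinitizable.finite_nonrealSpectrum (hT : IsDefinitizable K T) :
    (nonrealSpectrum T).Finite := by
  obtain ⟨p, hp⟩ := hT.exists_definitizing
  refine (finite_setOf_aeval_eq_zero hp.1).subset fun z hz => ?_
  by_contra h
  exact hz.1 (hT.selfAdjoint.mem_resolventSet_of_aeval_ne_zero hT.resolventSet_nonempty hp hz.2 h)

/-- Use a `p` of least order at `ω`. The condition on `ω` keeps it away from `w` and `conj w`, which
are nonreal points of the resolvent set. -/
theorem IsDefinitizable.eventually_norm_resolvent_le (hT : IsDefinitizable K T) {ω : ℂ}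
    (hω : ω.im = 0 ∨ ω ∉ resolventSet T) :
    ∃ C : ℝ, 0 ≤ C ∧ ∀ᶠ z in nhds ω, z ∈ resolventSet T → z.im ≠ 0 →
      ‖resolvent T z‖ ≤ C * (|z.im|⁻¹ * (‖z - ω‖ ^ orderFun K T ω)⁻¹) := by
  obtain ⟨p, hp, hpω⟩ := hT.exists_polyOrder_eq ω
  obtain ⟨w, hw, him⟩ := hT.selfAdjoint.exists_im_ne_zero hT.resolventSet_nonempty
  have hne : ∀ z, z ∈ resolventSet T → z.im ≠ 0 → z ≠ ω := by
    rintro z hz hz' rfl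
    exact hω.elim hz' fun h => h hz
  have h1 : 0 < ‖ω - w‖ := norm_pos_iff.2 (sub_ne_zero.2 (hne w hw him).symm)
  have h2 : 0 < ‖ω - conj w‖ := norm_pos_iff.2 (sub_ne_zero.2
    (hne _ (hT.selfAdjoint.conj_mem_resolventSet hw) (by simpa using him)).symm)
  set δ := min ‖ω - w‖ ‖ω - conj w‖ with hδ
  have hδ0 : 0 < δ := lt_min h1 h2
  obtain ⟨C, hC, hb⟩ := hT.selfAdjoint.exists_definitizing_bound hw him hp (m := p.natDegree)
    (by omega) (half_pos hδ0)
  obtain ⟨c, hc, hpc⟩ := exists_pow_le_norm_aeval hp.1 ω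
  rw [hpω] at hpc
  set M := ‖(ω - w) * (ω - conj w)‖ ^ p.natDegree + 1 with hM
  have hM0 : 0 ≤ M := by positivity
  refine ⟨C * M / c, by positivity, ?_⟩
  have hc1 : Continuous fun z : ℂ => ‖z - w‖ := by fun_prop
  have hc2 : Continuous fun z : ℂ => ‖z - conj w‖ := by fun_prop
  have hc3 : Continuous fun z : ℂ => ‖(z - w) * (z - conj w)‖ ^ p.natDegree := by fun_prop
  filter_upwards [hpc,
    (hc1.tendsto ω).eventually (lt_mem_nhds ((half_lt_self hδ0).trans_le (min_le_left _ _))),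
    (hc2.tendsto ω).eventually (lt_mem_nhds ((half_lt_self hδ0).trans_le (min_le_right _ _))),
    (hc3.tendsto ω).eventually (gt_mem_nhds (lt_add_one _))] with z hz1 hz2 hz3 hz4 hz hz'
  have h5 : 0 < ‖z - ω‖ := norm_pos_iff.2 (sub_ne_zero.2 (hne z hz hz'))
  refine InverseBound.norm_resolvent_le (fun u => ?_) (by positivity) hz
  have h6 := hb z hz2.le hz3.le u
  have h7 : |z.im| * (c * ‖z - ω‖ ^ orderFun K T ω * ‖(u : E)‖) ≤
      C * M * ‖T u - z • (u : E)‖ := by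
    calc _ ≤ |z.im| * (‖Polynomial.aeval z p‖ * ‖(u : E)‖) := by gcongr
      _ ≤ _ := h6
      _ ≤ _ := by gcongr
  have h8 : 0 < |z.im| := abs_pos.2 hz'
  have h9 : C * M / c * (|z.im|⁻¹ * (‖z - ω‖ ^ orderFun K T ω)⁻¹) * ‖T u - z • (u : E)‖ =
      C * M * ‖T u - z • (u : E)‖ / (|z.im| * (c * ‖z - ω‖ ^ orderFun K T ω)) := by
    field_simp
  rw [h9, le_div_iff₀ (by positivity)]
  linarith

theorem IsDefinitizable.eventually_norm_resolvent_le_cobounded (hT : IsDefinitizable K T) :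
    ∃ C : ℝ, 0 ≤ C ∧ ∀ᶠ z in Bornology.cobounded ℂ, z ∈ resolventSet T → z.im ≠ 0 →
      ‖resolvent T z‖ ≤ C * (|z.im|⁻¹ * ‖z‖ ^ orderFun K T ∞) := by
  obtain ⟨p, hp, hpω⟩ := hT.exists_polyOrder_eq ∞
  obtain ⟨w, hw, him⟩ := hT.selfAdjoint.exists_im_ne_zero hT.resolventSet_nonempty
  -- The least `m` with `n ≤ 2 m`: the loss at infinity, of order `|z| ^ (2 m - n)`, is then exactly
  -- the parity defect.
  obtain ⟨m, hm⟩ : ∃ m, 2 * m = p.natDegree + orderFun K T ∞ := by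
    rw [← hpω, polyOrder_infty]
    split_ifs with h
    · obtain ⟨m, hm⟩ := h
      exact ⟨m, by omega⟩
    · obtain ⟨m, hm⟩ := Nat.not_even_iff_odd.1 h
      exact ⟨m + 1, by omega⟩
  obtain ⟨C, hC, hb⟩ := hT.selfAdjoint.exists_definitizing_bound hw him hp (m := m)
    (by omega) one_pos
  obtain ⟨c, hc, hpc⟩ := exists_pow_le_norm_aeval_cobounded hp.1
  refine ⟨C * 4 ^ m / c, by positivity, ?_⟩
  filter_upwards [hpc, tendsto_norm_cobounded_atTop.eventually_ge_atTop (‖w‖ + 1)]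
    with z hz1 hz2 hz hz'
  have hconj : ‖conj w‖ = ‖w‖ := RCLike.norm_conj w
  have h3 := norm_sub_norm_le z w
  have h4 := norm_sub_norm_le z (conj w)
  have h5 := norm_sub_le z w
  have h6 := norm_sub_le z (conj w)
  have hz0 : 0 < ‖z‖ := by linarith [norm_nonneg w]
  have h7 : ‖(z - w) * (z - conj w)‖ ^ m ≤ 4 ^ m * ‖z‖ ^ (2 * m) := by
    rw [pow_mul, ← mul_pow]
    refine pow_le_pow_left₀ (norm_nonneg _) ?_ m
    rw [norm_mul]
    calc _ ≤ (2 * ‖z‖) * (2 * ‖z‖) :=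
          mul_le_mul (by linarith) (by linarith) (norm_nonneg _) (by positivity)
      _ = _ := by ring
  refine InverseBound.norm_resolvent_le (fun u => ?_) (by positivity) hz
  have h8 := hb z (by linarith) (by linarith) u
  have h9 : |z.im| * (c * ‖z‖ ^ p.natDegree * ‖(u : E)‖) ≤
      C * (4 ^ m * ‖z‖ ^ (2 * m)) * ‖T u - z • (u : E)‖ := by
    calc _ ≤ |z.im| * (‖Polynomial.aeval z p‖ * ‖(u : E)‖) := by gcongr
      _ ≤ _ := h8
      _ ≤ _ := by gcongr
  have h10 : 0 < |z.im| := abs_pos.2 hz'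
  rw [hm, pow_add] at h9
  have h11 : C * 4 ^ m / c * (|z.im|⁻¹ * ‖z‖ ^ orderFun K T ∞) * ‖T u - z • (u : E)‖ =
      C * (4 ^ m * (‖z‖ ^ p.natDegree * ‖z‖ ^ orderFun K T ∞)) * ‖T u - z • (u : E)‖ /
        (|z.im| * (c * ‖z‖ ^ p.natDegree)) := by
    field_simp
  rw [h11, le_div_iff₀ (by positivity)]
  linarith

end Order

/-! ### From local estimates to the global one. -/

section Estimate

variable {E : Type*} [NormedAddCommGroup E] [NormedSpace ℂ E]

theorem le_finsum_mem {ι : Type*} {s : Set ι} (hs : s.Finite) {f : ι → ℝ} (hf : ∀ i, 0 ≤ f i)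
    {i : ι} (hi : i ∈ s) : f i ≤ ∑ᶠ j ∈ s, f j := by
  rw [finsum_mem_eq_finite_toFinset_sum f hs]
  exact Finset.single_le_sum (fun j _ => hf j) (hs.mem_toFinset.2 hi)

/-- The right-hand side of the resolvent estimate. -/
noncomputable def resolventMajorant (K : KreinStructure E) (T : E →ₗ.[ℂ] E) (z : ℂ) : ℝ :=
  (∑ᶠ ξ ∈ nonrealSpectrum T, (‖z - ξ‖ ^ orderFun K T (ξ : OnePoint ℂ))⁻¹) +
    |z.im|⁻¹ * (1 + (∑ᶠ ξ ∈ realCriticalPoints K T,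
      (‖z - (ξ : ℂ)‖ ^ orderFun K T ((ξ : ℂ) : OnePoint ℂ))⁻¹) + ‖z‖ ^ orderFun K T ∞)

variable {K : KreinStructure E} {T : E →ₗ.[ℂ] E} [CompleteSpace E]

theorem IsDefinitizable.le_resolventMajorant (hT : IsDefinitizable K T) (z : ℂ) :
    0 ≤ resolventMajorant K T z ∧ |z.im|⁻¹ ≤ resolventMajorant K T z ∧
    |z.im|⁻¹ * ‖z‖ ^ orderFun K T ∞ ≤ resolventMajorant K T z ∧
    (∀ ξ ∈ nonrealSpectrum T,
      (‖z - ξ‖ ^ orderFun K T (ξ : OnePoint ℂ))⁻¹ ≤ resolventMajorant K T z) ∧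
    ∀ ξ ∈ realCriticalPoints K T,
      |z.im|⁻¹ * (‖z - (ξ : ℂ)‖ ^ orderFun K T ((ξ : ℂ) : OnePoint ℂ))⁻¹ ≤
        resolventMajorant K T z := by
  obtain ⟨p, hp⟩ := hT.exists_definitizing
  have h1 := fun ξ (hξ : ξ ∈ nonrealSpectrum T) => le_finsum_mem hT.finite_nonrealSpectrum
    (f := fun ξ => (‖z - ξ‖ ^ orderFun K T (ξ : OnePoint ℂ))⁻¹) (fun ξ => by positivity) hξ
  have h2 := fun ξ (hξ : ξ ∈ realCriticalPoints K T) => le_finsum_mem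
    (finite_realCriticalPoints hp)
    (f := fun ξ : ℝ => (‖z - (ξ : ℂ)‖ ^ orderFun K T ((ξ : ℂ) : OnePoint ℂ))⁻¹)
    (fun ξ => by positivity) hξ
  have h3 : 0 ≤ ∑ᶠ ξ ∈ nonrealSpectrum T, (‖z - ξ‖ ^ orderFun K T (ξ : OnePoint ℂ))⁻¹ :=
    finsum_nonneg fun ξ => finsum_nonneg fun _ => by positivity
  have h4 : 0 ≤ ∑ᶠ ξ ∈ realCriticalPoints K T,
      (‖z - (ξ : ℂ)‖ ^ orderFun K T ((ξ : ℂ) : OnePoint ℂ))⁻¹ :=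
    finsum_nonneg fun ξ => finsum_nonneg fun _ => by positivity
  have h5 : 0 ≤ |z.im|⁻¹ := by positivity
  have h6 : 0 ≤ ‖z‖ ^ orderFun K T ∞ := by positivity
  unfold resolventMajorant
  refine ⟨by positivity, ?_, ?_, fun ξ hξ => ?_, fun ξ hξ => ?_⟩
  · nlinarith
  · nlinarith
  · have := h1 ξ hξ
    have h7 := mul_nonneg h5 (add_nonneg (add_nonneg zero_le_one h4) h6)
    linarith
  · have := mul_le_mul_of_nonneg_left (h2 ξ hξ) h5
    nlinarith

/-- At real `ω` the local estimate is a term of the majorant; at nonreal `ω` in the resolvent set,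
the resolvent is locally bounded while `|Im z|⁻¹` is bounded below; at nonreal spectral points `|Im
z|⁻¹` is bounded and goes into the constant. -/
theorem IsDefinitizable.eventually_norm_resolvent_le_majorant (hT : IsDefinitizable K T) (ω : ℂ) :
    ∃ C : ℝ, 0 ≤ C ∧ ∀ᶠ z in nhds ω, z ∈ resolventSet T → z.im ≠ 0 →
      ‖resolvent T z‖ ≤ C * resolventMajorant K T z := by
  by_cases hω : ω.im = 0
  · obtain ⟨C, hC, h⟩ := hT.eventually_norm_resolvent_le (Or.inl hω)
    refine ⟨C, hC, h.mono fun z h hz hz' => (h hz hz').trans ?_⟩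
    refine mul_le_mul_of_nonneg_left ?_ hC
    obtain ⟨-, h1, -, -, h2⟩ := hT.le_resolventMajorant z
    have hωr : ((ω.re : ℝ) : ℂ) = ω := Complex.ext rfl hω.symm
    by_cases h0 : orderFun K T ω = 0
    · simpa [h0] using h1
    · have := h2 ω.re (by change orderFun K T _ ≠ 0; rwa [hωr])
      rwa [hωr] at this
  · have hcont : Continuous fun z : ℂ => |z.im| := Complex.continuous_im.abs
    have hpos : 0 < |ω.im| := abs_pos.2 hω
    by_cases hρ : ω ∈ resolventSet T
    · obtain ⟨C, hC, h⟩ := eventually_inverseBound hρ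
      refine ⟨C * (|ω.im| + 1), by positivity, ?_⟩
      filter_upwards [h, (hcont.tendsto ω).eventually (gt_mem_nhds (lt_add_one _))]
        with z hz1 hz2 hz hz'
      refine (hz1.norm_resolvent_le hC hz).trans ?_
      rw [mul_assoc]
      refine le_mul_of_one_le_right hC ?_
      obtain ⟨-, h1, -⟩ := hT.le_resolventMajorant z
      have h3 : 0 < |z.im| := abs_pos.2 hz'
      calc (1 : ℝ) = |z.im| * |z.im|⁻¹ := (mul_inv_cancel₀ h3.ne').symm
        _ ≤ _ := mul_le_mul hz2.le h1 (by positivity) (by positivity)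
    · obtain ⟨C, hC, h⟩ := hT.eventually_norm_resolvent_le (Or.inr hρ)
      refine ⟨C * (|ω.im| / 2)⁻¹, by positivity, ?_⟩
      filter_upwards [h, (hcont.tendsto ω).eventually (lt_mem_nhds (half_lt_self hpos))]
        with z hz1 hz2 hz hz'
      refine (hz1 hz hz').trans ?_
      rw [mul_assoc]
      refine mul_le_mul_of_nonneg_left ?_ hC
      obtain ⟨-, -, -, h1, -⟩ := hT.le_resolventMajorant z
      exact mul_le_mul (inv_anti₀ (half_pos hpos) hz2.le) (h1 ω ⟨hρ, hω⟩) (by positivity)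
        (by positivity)

theorem IsDefinitizable.exists_norm_resolvent_le_majorant (hT : IsDefinitizable K T) :
    ∃ C : ℝ, 0 ≤ C ∧ ∀ z ∈ resolventSet T, z.im ≠ 0 →
      ‖resolvent T z‖ ≤ C * resolventMajorant K T z := by
  obtain ⟨C, hC, h⟩ := hT.eventually_norm_resolvent_le_cobounded
  obtain ⟨r, -, hr⟩ := Filter.hasBasis_cobounded_norm.eventually_iff.1 h
  have hcomp : ∃ C : ℝ, 0 ≤ C ∧ ∀ z ∈ Metric.closedBall (0 : ℂ) r, z ∈ resolventSet T →
      z.im ≠ 0 → ‖resolvent T z‖ ≤ C * resolventMajorant K T z := by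
    -- Having such a bound on a set passes to subsets and finite unions, so the local bounds suffice
    -- on a compact disc.
    refine (isCompact_closedBall (0 : ℂ) r).induction_on
      (p := fun s => ∃ C : ℝ, 0 ≤ C ∧ ∀ z ∈ s, z ∈ resolventSet T → z.im ≠ 0 →
        ‖resolvent T z‖ ≤ C * resolventMajorant K T z) ?_ ?_ ?_ ?_
    · exact ⟨0, le_rfl, fun z hz => hz.elim⟩
    · rintro s t hst ⟨C, hC, h⟩
      exact ⟨C, hC, fun z hz => h z (hst hz)⟩
    · rintro s t ⟨C, hC, h⟩ ⟨C', hC', h'⟩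
      refine ⟨max C C', hC.trans (le_max_left _ _), fun z hz hz1 hz2 => ?_⟩
      have h0 := (hT.le_resolventMajorant z).1
      rcases hz with hz | hz
      · exact (h z hz hz1 hz2).trans (mul_le_mul_of_nonneg_right (le_max_left _ _) h0)
      · exact (h' z hz hz1 hz2).trans (mul_le_mul_of_nonneg_right (le_max_right _ _) h0)
    · intro ω _
      obtain ⟨C, hC, h⟩ := hT.eventually_norm_resolvent_le_majorant ω
      exact ⟨_, mem_nhdsWithin_of_mem_nhds h, C, hC, fun z hz => hz⟩
  obtain ⟨C', hC', h'⟩ := hcomp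
  refine ⟨max C C', hC.trans (le_max_left _ _), fun z hz hz' => ?_⟩
  obtain ⟨h0, -, h1, -⟩ := hT.le_resolventMajorant z
  rcases le_total r ‖z‖ with hrz | hrz
  · exact (hr hrz hz hz').trans (mul_le_mul (le_max_left _ _) h1 (by positivity)
      (hC.trans (le_max_left _ _)))
  · exact (h' z (by simpa using hrz) hz hz').trans
      (mul_le_mul_of_nonneg_right (le_max_right _ _) h0)

end Estimate

end KreinResolvent

theorem mainTheorem6 {E : Type*} [NormedAddCommGroup E] [NormedSpace ℂ E] [CompleteSpace E]
    (K : KreinResolvent.KreinStructure E) (H : E →ₗ.[ℂ] E)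
    (hH : KreinResolvent.IsDefinitizable K H) :
    (KreinResolvent.nonrealSpectrum H).Finite ∧
    (KreinResolvent.realCriticalPoints K H).Finite ∧
    (KreinResolvent.orderFun K H ∞ = 0 ∨ KreinResolvent.orderFun K H ∞ = 1) ∧
    ∃ c : ℝ, 0 < c ∧ ∀ z : ℂ, z ∉ KreinResolvent.nonrealSpectrum H → z.im ≠ 0 →
      z ∈ KreinResolvent.resolventSet H ∧
      c * ‖KreinResolvent.resolvent H z‖ ≤
        (∑ᶠ ξ ∈ KreinResolvent.nonrealSpectrum H,
          (‖z - ξ‖ ^ KreinResolvent.orderFun K H (ξ : OnePoint ℂ))⁻¹) +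
        |z.im|⁻¹ *
          (1 + (∑ᶠ ξ ∈ KreinResolvent.realCriticalPoints K H,
              (‖z - (ξ : ℂ)‖ ^ KreinResolvent.orderFun K H ((ξ : ℂ) : OnePoint ℂ))⁻¹) +
            ‖z‖ ^ KreinResolvent.orderFun K H ∞) := by
  obtain ⟨p, hp, hpo⟩ := hH.exists_polyOrder_eq ∞
  refine ⟨hH.finite_nonrealSpectrum, KreinResolvent.finite_realCriticalPoints hp, ?_, ?_⟩
  · rw [← hpo, KreinResolvent.polyOrder_infty]
    split_ifs
    exacts [Or.inl rfl, Or.inr rfl]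
  · obtain ⟨C, hC, h⟩ := hH.exists_norm_resolvent_le_majorant
    -- `C` may be zero, hence `C + 1`.
    refine ⟨(C + 1)⁻¹, by positivity, fun z hz hz' => ?_⟩
    have hρ : z ∈ KreinResolvent.resolventSet H := by
      by_contra h0
      exact hz ⟨h0, hz'⟩
    refine ⟨hρ, ?_⟩
    change _ ≤ KreinResolvent.resolventMajorant K H z
    rw [inv_mul_le_iff₀ (by positivity)]
    exact (h z hρ hz').trans (mul_le_mul_of_nonneg_right (by linarith)
      (hH.le_resolventMajorant z).1)
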